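/- Let $I$ and $A$ be finite sets with $I\neq\emptyset$, and let $\{\alpha_i\mid i\in I\}$ be the standard basis of $\mathbb Z^I$. Let $\mathcal C=\mathcal C(I,A,(\rho_i)_{i\in I},(C^a)_{a\in A})$ be a Cartan scheme: the $\rho_i:A\to A$ are maps with $\rho_i^2=\mathrm{id}$, and the $C^a=(c^a_{jk})_{j,k\in I}$ are generalized Cartan matrices (integer matrices with $c_{jj}=2$, $c_{jk}\le 0$ for $j\ne k$, and $c_{jk}=0\Rightarrow c_{kj}=0$) with $c^a_{ij}=c^{\rho_i(a)}_{ij}$. Let $\sigma_i^a\in\mathrm{Aut}(\mathbb Z^I)$, $\sigma_i^a(\alpha_j)=\alpha_j-c^a_{ij}\alpha_i$. The Weyl groupoid $\mathcal W(\mathcal C)$ has object set $A$, and its morphisms are the compositions of the maps $\sigma_i^a\in\mathrm{Hom}(a,\rho_i(a))$. For a morphism $w$ let $\ell(w)$ be the least $k$ such that $w=\sigma_{i_1}\cdots\sigma_{i_k}$, and for $a\in A$ let $\mathrm{Hom}(-,a)=\bigsqcup_{b\in A}\mathrm{Hom}(b,a)$. For $J\subseteq I$ let $\mathcal W_J(\mathcal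 C)$ be the smallest subgroupoid containing all objects and all $\sigma_j^a$ with $j\in J$, $a\in A$. Let $R^a=\{w(\alpha_j)\mid w\in\mathrm{Hom}(-,a),\ j\in I\}$ be the set of real roots at $a$, and assume that $(R^a)_{a\in A}$ is a finite root system of type $\mathcal C$, that is, every $R^a$ is finite and, for all $a\in A$ and $i,j\in I$: (R1) $R^a=R^a_+\cup -R^a_+$, where $R^a_+=R^a\cap\mathbb N_0^I$; (R2) $R^a\cap\mathbb Z\alpha_i=\{\alpha_i,-\alpha_i\}$; (R3) $\sigma_i^a(R^a)=R^{\rho_i(a)}$; (R4) if $i\ne j$ and $m=|R^a\cap(\mathbb N_0\alpha_i+\mathbb N_0\alpha_j)|$ is finite, then $(\rho_i\rho_j)^{m}(a)=a$. Fix $a\in A$. The (right) weak order on $\mathrm{Hom}(-,a)$ is given by $u\le_R uv:\Leftrightarrow \ell(u)+\ell(v)=\ell(uv)$. The Coxeter complex $\Delta^a_{\mathcal C}$ is the simplicial complex on the vertex set $\Omega=\{w\mathcal W_J(\mathcal C)\mid w\in\mathrm{Hom}(-,a),\ J\subseteq I,\ |J|=|I|-1\}$ whose faces are the non-empty subsets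 $F\subseteq\Omega$ with $\bigcap_{X\in F}X\ne\emptyset$. For $w\in\mathrm{Hom}(-,a)$ let $F_w=\{w\mathcal W_J(\mathcal C)\mid J\subseteq I,\ |J|=|I|-1\}$. Theorem. Let $\preceq$ be any linear extension of the weak order $\le_R$ on $\mathrm{Hom}(-,a)$. Then $\preceq$ is a shelling order for $\Delta^a_{\mathcal C}$. That is: $\mathrm{Hom}(-,a)$ is finite; the map $w\mapsto F_w$ is a bijection from $\mathrm{Hom}(-,a)$ onto the set of inclusionwise maximal faces of $\Delta^a_{\mathcal C}$; $\Delta^a_{\mathcal C}$ is pure (all maximal faces have the same dimension); and if $w_1\prec w_2\prec\dots\prec w_r$ are the elements of $\mathrm{Hom}(-,a)$, then for all $1\le i<j\le r$ there are $l<j$ and $\omega\in F_{w_j}$ with $F_{w_i}\cap F_{w_j}\subseteq F_{w_l}\cap F_{w_j}=F_{w_j}\setminus\{\omega\}$. -/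

import Mathlib

open CategoryTheory

/-- A Cartan scheme `𝒞(I, A, (ρ_i), (C^a))`: each `ρ i` is an involution of `A`, each `cartan a` is a
generalized Cartan matrix, and the `i`-th rows of `C^a` and `C^{ρ_i(a)}` agree. -/
structure CartanScheme (I A : Type*) where
  ρ : I → A → A
  cartan : A → Matrix I I ℤ
  diag : ∀ a i, cartan a i i = 2
  offDiag_nonpos : ∀ a i j, i ≠ j → cartan a i j ≤ 0
  eq_zero_symm : ∀ a i j, cartan a i j = 0 → cartan a j i = 0
  ρ_ρ : ∀ i a, ρ i (ρ i a) = a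
  cartan_ρ : ∀ a i j, cartan (ρ i a) i j = cartan a i j

namespace CartanScheme

set_option linter.unusedSectionVars false

variable {I A : Type*} [Fintype I] [DecidableEq I]

/-- The standard basis vector `α_i` of `ℤ^I`. -/
def α (i : I) : I → ℤ := Pi.single i 1

/-- The linear form `α_j ↦ c_{ij}^a` on `ℤ^I`. -/
def coroot (C : CartanScheme I A) (i : I) (a : A) : (I → ℤ) →ₗ[ℤ] ℤ :=
  LinearMap.proj i ∘ₗ (C.cartan a).mulVecLin

theorem coroot_α (C : CartanScheme I A) (i : I) (a : A) (j : I) :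
    C.coroot i a (α j) = C.cartan a i j := by
  simp [coroot, α]

/-- The reflection `σ_i^a ∈ Aut(ℤ^I)`. -/
def σ (C : CartanScheme I A) (i : I) (a : A) : (I → ℤ) ≃ₗ[ℤ] (I → ℤ) :=
  Module.reflection (x := α i) (f := C.coroot i a) (by rw [coroot_α, C.diag])

theorem σ_α (C : CartanScheme I A) (i : I) (a : A) (j : I) :
    C.σ i a (α j) = α j - C.cartan a i j • α i := by
  rw [σ, Module.reflection_apply, coroot_α]

theorem σ_ρ (C : CartanScheme I A) (i : I) (a : A) : C.σ i (C.ρ i a) = C.σ i a := by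
  have h : C.coroot i (C.ρ i a) = C.coroot i a := by
    ext j
    simp [coroot, C.cartan_ρ]
  ext1 v
  simp only [σ, Module.reflection_apply, h]

theorem σ_mul_σ (C : CartanScheme I A) (i : I) (a : A) : C.σ i a * C.σ i a = 1 := by
  ext1 v
  exact Module.involutive_reflection _ v

/-- The object `ρ_{i_1} ⋯ ρ_{i_k}(a)` for the word `[i_1, …, i_k]`. -/
def wordObj (C : CartanScheme I A) : List I → A → A
  | [], a => a
  | i :: l, a => C.ρ i (C.wordObj l a)

/-- The map `σ_{i_1} ⋯ σ_{i_k}^a` for the word `[i_1, …, i_k]`. -/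
def wordMap (C : CartanScheme I A) : List I → A → ((I → ℤ) ≃ₗ[ℤ] (I → ℤ))
  | [], _ => 1
  | i :: l, a => C.σ i (C.wordObj l a) * C.wordMap l a

theorem wordObj_append (C : CartanScheme I A) (l m : List I) (a : A) :
    C.wordObj (l ++ m) a = C.wordObj l (C.wordObj m a) := by
  induction l with
  | nil => rfl
  | cons i l ih => simp [wordObj, ih]

theorem wordMap_append (C : CartanScheme I A) (l m : List I) (a : A) :
    C.wordMap (l ++ m) a = C.wordMap l (C.wordObj m a) * C.wordMap m a := by
  induction l with
  | nil => simp [wordMap]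
  | cons i l ih => simp [wordMap, ih, wordObj_append, mul_assoc]

theorem wordObj_reverse (C : CartanScheme I A) (l : List I) (a : A) :
    C.wordObj l.reverse (C.wordObj l a) = a := by
  induction l with
  | nil => rfl
  | cons i l ih => simp [wordObj_append, wordObj, C.ρ_ρ, ih]

theorem wordMap_reverse (C : CartanScheme I A) (l : List I) (a : A) :
    C.wordMap l.reverse (C.wordObj l a) = (C.wordMap l a)⁻¹ := by
  rw [eq_inv_iff_mul_eq_one]
  induction l with
  | nil => simp [wordMap]
  | cons i l ih =>
    simp only [List.reverse_cons, wordMap_append, wordObj, wordMap, mul_one, σ_ρ, C.ρ_ρ]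
    calc _ = C.wordMap l.reverse (C.wordObj l a) *
          (C.σ i (C.wordObj l a) * C.σ i (C.wordObj l a)) * C.wordMap l a := by group
      _ = 1 := by rw [σ_mul_σ, mul_one, ih]

/-- The object type of the Weyl groupoid of `C`: a copy of `A`. -/
structure WeylGroupoid (C : CartanScheme I A) where
  obj : A

/-- Morphisms `a ⟶ b` of the Weyl groupoid: the automorphisms of `ℤ^I` that are compositions
`σ_{i_1} ⋯ σ_{i_k}^a` with `ρ_{i_1} ⋯ ρ_{i_k}(a) = b`. -/
@[ext]
structure WeylHom (C : CartanScheme I A) (a b : A) where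
  val : (I → ℤ) ≃ₗ[ℤ] (I → ℤ)
  exists_word : ∃ l : List I, C.wordObj l a = b ∧ C.wordMap l a = val

/-- The composition `f ≫ g` is the map `v ↦ g (f v)`. -/
instance (C : CartanScheme I A) : Groupoid (WeylGroupoid C) where
  Hom a b := C.WeylHom a.obj b.obj
  id _ := ⟨1, [], rfl, rfl⟩
  comp f g := ⟨g.val * f.val, by
    obtain ⟨l, hl, hf⟩ := f.exists_word
    obtain ⟨m, hm, hg⟩ := g.exists_word
    refine ⟨m ++ l, by rw [wordObj_append, hl, hm], ?_⟩
    rw [wordMap_append, ← hf, ← hg]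
    exact congrArg (fun b => C.wordMap m b * _) hl⟩
  inv f := ⟨f.val⁻¹, by
    obtain ⟨l, hl, hf⟩ := f.exists_word
    exact ⟨l.reverse, by rw [← hl, wordObj_reverse], by
      rw [← hf, ← wordMap_reverse]; exact congrArg _ hl.symm⟩⟩
  id_comp _ := WeylHom.ext (mul_one _)
  comp_id _ := WeylHom.ext (one_mul _)
  assoc _ _ _ := WeylHom.ext (mul_assoc _ _ _).symm
  inv_comp f := WeylHom.ext (mul_inv_cancel f.val)
  comp_inv f := WeylHom.ext (inv_mul_cancel f.val)

/-- The automorphism of `ℤ^I` underlying a morphism. -/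
def toAut {C : CartanScheme I A} {a b : WeylGroupoid C} (f : a ⟶ b) : (I → ℤ) ≃ₗ[ℤ] (I → ℤ) :=
  WeylHom.val f

/-- `σ_i^a` as a morphism from `a` to `ρ_i(a)`. -/
def s (C : CartanScheme I A) (i : I) (a : A) :
    (⟨a⟩ : WeylGroupoid C) ⟶ ⟨C.ρ i a⟩ :=
  ⟨C.σ i a, [i], rfl, mul_one _⟩

/-- The length `ℓ(w)`: the least length of a decomposition of `w` into simple reflections. -/
noncomputable def len {C : CartanScheme I A} {a b : WeylGroupoid C} (w : a ⟶ b) : ℕ :=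
  sInf {k | ∃ l : List I, l.length = k ∧ C.wordObj l a.obj = b.obj ∧ C.wordMap l a.obj = toAut w}

/-- The parabolic subgroupoid `W_J(C)`: the smallest subgroupoid which contains all objects and all
`σ_j^a` with `j ∈ J`. -/
def parabolic (C : CartanScheme I A) (J : Finset I) : Subgroupoid (WeylGroupoid C) :=
  sInf {S | S.IsWide ∧
    ∀ j ∈ J, ∀ a : A, C.s j a ∈ S.arrows ⟨a⟩ ⟨C.ρ j a⟩}

/-- `Hom(-, a)`: the disjoint union over all objects `b` of `Hom(b, a)`. -/
def HomTo (C : CartanScheme I A) (a : A) : Type _ :=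
  Σ b : WeylGroupoid C, (b ⟶ ⟨a⟩)

/-- The set of real roots at `a`. -/
def realRoots (C : CartanScheme I A) (a : A) : Set (I → ℤ) :=
  {β | ∃ (w : C.HomTo a) (j : I), toAut w.2 (α j) = β}

/-- `(R^a)_{a ∈ A}` is a root system of type `C`. -/
structure IsRootSystem (C : CartanScheme I A) (R : A → Set (I → ℤ)) : Prop where
  pos_or_neg : ∀ a, R a = {β ∈ R a | 0 ≤ β} ∪ {β | -β ∈ R a ∧ 0 ≤ -β}
  multiples : ∀ a i, R a ∩ {β | ∃ n : ℤ, β = n • α i} = {α i, -α i}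
  image_σ : ∀ a i, C.σ i a '' R a = R (C.ρ i a)
  iterate_ρ : ∀ a i j, i ≠ j →
    (R a ∩ {β | ∃ m n : ℕ, β = m • α i + n • α j}).Finite →
    (fun b => C.ρ i (C.ρ j b))^[(R a ∩ {β | ∃ m n : ℕ, β = m • α i + n • α j}).ncard] a = a

/-- The (right) weak order on `Hom(-, a)`: `u ≤ uv` if and only if `ℓ(u) + ℓ(v) = ℓ(uv)`. -/
def WeakLE {C : CartanScheme I A} {a : A} (u w : C.HomTo a) : Prop :=
  ∃ v : w.1 ⟶ u.1, w.2 = v ≫ u.2 ∧ len u.2 + len v = len w.2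

/-- The left coset `w W_J(C)`, as a subset of `Hom(-, a)`. -/
def leftCoset {C : CartanScheme I A} {a : A} (w : C.HomTo a) (J : Finset I) :
    Set (C.HomTo a) :=
  {x | ∃ v : x.1 ⟶ w.1, v ∈ (C.parabolic J).arrows x.1 w.1 ∧ x.2 = v ≫ w.2}

/-- The ground set of the Coxeter complex: all cosets `w W_J(C)` with `|J| = |I| - 1`. -/
def coxeterVertices (C : CartanScheme I A) (a : A) : Set (Set (C.HomTo a)) :=
  {X | ∃ (w : C.HomTo a) (J : Finset I), J.card + 1 = Fintype.card I ∧ X = leftCoset w J}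

/-- The Coxeter complex of `C` at `a`: its faces are the non-empty sets of vertices with non-empty
intersection. -/
def coxeterComplex (C : CartanScheme I A) (a : A) :
    PreAbstractSimplicialComplex (Set (C.HomTo a)) where
  faces := {F | F.Nonempty ∧ (∀ X ∈ F, X ∈ C.coxeterVertices a) ∧ (⋂ X ∈ F, X).Nonempty}
  isRelLowerSet_faces := by
    rintro F ⟨hF, hv, x, hx⟩
    refine ⟨hF, fun G hGF hG => ⟨hG, fun X hX => hv X (hGF hX), x, ?_⟩⟩
    simp only [Set.mem_iInter] at hx ⊢
    exact fun X hX => hx X (hGF hX)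

open Classical in
/-- The simplex of the Coxeter complex that corresponds to `w ∈ Hom(-, a)`: its vertices are the
cosets `w W_J(C)` with `|J| = |I| - 1`. -/
noncomputable def chamber {C : CartanScheme I A} {a : A} (w : C.HomTo a) :
    Finset (Set (C.HomTo a)) :=
  (Finset.univ.filter fun J : Finset I => J.card + 1 = Fintype.card I).image (leftCoset w)

end CartanScheme

namespace PreAbstractSimplicialComplex

variable {V : Type*}

/-- All inclusionwise maximal faces have the same dimension. -/
def IsPure (K : PreAbstractSimplicialComplex V) : Prop :=
  ∀ F G : Finset V, Maximal (· ∈ K.faces) F → Maximal (· ∈ K.faces) G → F.card = G.card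

/-- `F_0, …, F_{r-1}` is a shelling order of `K`: the complex `K` is pure, the `F_i` are its maximal
faces, numbered without repetition, and for all `i < j` there are `l < j` and `ω ∈ F_j` with
`F_i ∩ F_j ⊆ F_l ∩ F_j = F_j \ {ω}`. -/
structure IsShelling (K : PreAbstractSimplicialComplex V) {r : ℕ} (F : Fin r → Finset V) :
    Prop where
  pure : K.IsPure
  injective : Function.Injective F
  range_eq : Set.range F = {G | Maximal (· ∈ K.faces) G}
  exists_lt : ∀ i j, i < j → ∃ l, l < j ∧ ∃ ω ∈ F j,
    (F i ∩ F j : Set V) ⊆ F l ∩ F j ∧ (F l ∩ F j : Set V) = (F j : Set V) \ {ω}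

end PreAbstractSimplicialComplex

namespace CartanScheme

set_option linter.unusedSectionVars false

variable {I A : Type*} [Fintype I] [DecidableEq I]

/-! Let `u` come strictly before `w` in the linear extension, so `w ≤_R u` fails. Call `k` a descent
of `w` if `w(α_k)` is negative. Suppose some descent `k` has `u W_{I∖k} ≠ w W_{I∖k}`. Then `w σ_k`
lies below `w` in the weak order, and its chamber shares with that of `w` every vertex except `w
W_{I∖k}`, which is not a vertex of the chamber of `u`. This is the shelling condition
(`exists_chamber_inter`).

Such a `k` exists (`weakLE_of_leftCoset_eq`): otherwise `v = w⁻¹u` preserves the `k`-th coordinate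
for every descent `k`. A positive root `β` with `v⁻¹β` negative then has coordinate zero at all
descents, so `wβ` is positive. Hence the inversions of `w` and `v` add up in `wv = u`, which means
`w ≤_R u`.

The last inference needs length to equal the number of inversions (`len_eq_ncard`). This rests on
the exchange property `Ascends.exchange`, which reduces to the rank-two Coxeter relations
`walk_comm`; those follow from (R4) on objects and from finiteness of the root sets on maps. -/

theorem eq_sum_α (v : I → ℤ) : v = ∑ k, v k • α k := by
  ext l
  simp [α, Finset.sum_apply, Pi.single_apply]

theorem map_eq_sum_α (f : (I → ℤ) ≃ₗ[ℤ] (I → ℤ)) (v : I → ℤ) : f v = ∑ k, v k • f (α k) := by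
  conv_lhs => rw [eq_sum_α v]
  rw [map_sum]
  exact Finset.sum_congr rfl fun k _ => map_smul f _ _

theorem α_nonneg (i : I) : 0 ≤ (α i : I → ℤ) := by
  intro k
  by_cases h : k = i <;> simp [α, h]

theorem not_nonneg_neg {v : I → ℤ} (h : 0 ≤ v) (h0 : v ≠ 0) : ¬ 0 ≤ -v :=
  fun h' => h0 (le_antisymm (by simpa using h') h)

theorem σ_apply_of_ne (C : CartanScheme I A) {i k : I} (h : k ≠ i) (a : A) (v : I → ℤ) :
    C.σ i a v k = v k := by
  simp [σ, Module.reflection_apply, α, h]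

theorem σ_α_self (C : CartanScheme I A) (i : I) (a : A) : C.σ i a (α i) = -α i := by
  rw [σ_α, C.diag]
  ext k
  simp
  ring

theorem σ_inv (C : CartanScheme I A) (i : I) (a : A) : (C.σ i a)⁻¹ = C.σ i a :=
  inv_eq_of_mul_eq_one_left (C.σ_mul_σ i a)

theorem σ_σ (C : CartanScheme I A) (i : I) (a : A) (v : I → ℤ) : C.σ i a (C.σ i a v) = v :=
  LinearEquiv.congr_fun (C.σ_mul_σ i a) v

/-! ### Positive roots and inversion counts. -/

section Roots

variable [Nonempty I] {C : CartanScheme I A} {R : A → Set (I → ℤ)}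

namespace IsRootSystem

theorem α_mem (hR : C.IsRootSystem R) (a : A) (i : I) : α i ∈ R a := by
  have : α i ∈ R a ∩ {β | ∃ n : ℤ, β = n • α i} := by
    rw [hR.multiples]
    exact Or.inl rfl
  exact this.1

theorem nonneg_or (hR : C.IsRootSystem R) {a : A} {β : I → ℤ} (h : β ∈ R a) :
    0 ≤ β ∨ 0 ≤ -β := by
  rw [hR.pos_or_neg a] at h
  exact h.imp And.right And.right

theorem neg_mem (hR : C.IsRootSystem R) {a : A} {β : I → ℤ} (h : β ∈ R a) : -β ∈ R a := by
  have h' := h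
  rw [hR.pos_or_neg a] at h'
  rcases h' with h' | h'
  · rw [hR.pos_or_neg a]
    exact Or.inr ⟨by simpa using h, by simpa using h'.2⟩
  · exact h'.1

theorem eq_α (hR : C.IsRootSystem R) {a : A} {β : I → ℤ} (h : β ∈ R a) (h0 : 0 ≤ β) {i : I}
    (hi : ∀ k, k ≠ i → β k = 0) : β = α i := by
  have h1 : β = β i • α i := by
    ext k
    by_cases hk : k = i
    · subst hk
      simp [α]
    · simp [α, hk, hi k hk]
  have h2 : β ∈ R a ∩ {β | ∃ n : ℤ, β = n • α i} := ⟨h, _, h1⟩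
  rw [hR.multiples] at h2
  rcases h2 with h2 | h2
  · exact h2
  · have := h0 i
    rw [h2] at this
    simp [α] at this

theorem ne_zero (hR : C.IsRootSystem R) {a : A} {β : I → ℤ} (h : β ∈ R a) : β ≠ 0 := by
  rintro rfl
  obtain ⟨i⟩ := ‹Nonempty I›
  have := congrFun (hR.eq_α h le_rfl (i := i) fun _ _ => rfl) i
  simp [α] at this

theorem σ_mem (hR : C.IsRootSystem R) {a : A} {β : I → ℤ} (i : I) (h : β ∈ R a) :
    C.σ i a β ∈ R (C.ρ i a) := by
  rw [← hR.image_σ]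
  exact Set.mem_image_of_mem _ h

theorem σ_mem_iff (hR : C.IsRootSystem R) {a : A} {β : I → ℤ} (i : I) :
    C.σ i a β ∈ R a ↔ β ∈ R (C.ρ i a) := by
  constructor
  · intro h
    simpa [σ_σ] using hR.σ_mem i h
  · intro h
    simpa [C.ρ_ρ, σ_ρ] using hR.σ_mem i h

/-- The reflection changes only the `i`-th coordinate. A negative image would force all other
coordinates of `β` to vanish, and (R2) leaves only `α i`. -/
theorem σ_nonneg (hR : C.IsRootSystem R) {a : A} {β : I → ℤ} {i : I} (h : β ∈ R a) (h0 : 0 ≤ β)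
    (hi : β ≠ α i) : 0 ≤ C.σ i a β := by
  by_contra hn
  have h1 : 0 ≤ -C.σ i a β := (hR.nonneg_or (hR.σ_mem i h)).resolve_left hn
  refine hi (hR.eq_α h h0 fun k hk => le_antisymm ?_ (h0 k))
  have := h1 k
  simpa [σ_apply_of_ne C hk] using this

end IsRootSystem

/-- The positive roots in `R a` with support in `S`. -/
def posRoots (R : A → Set (I → ℤ)) (S : Set I) (a : A) : Set (I → ℤ) :=
  {β | β ∈ R a ∧ 0 ≤ β ∧ ∀ k ∉ S, β k = 0}

/-- The positive roots in `R a` with support in `S` which `f` does not map to positive roots. -/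
def inversions (R : A → Set (I → ℤ)) (S : Set I) (a : A) (f : (I → ℤ) ≃ₗ[ℤ] (I → ℤ)) :
    Set (I → ℤ) :=
  {β | β ∈ posRoots R S a ∧ ¬ 0 ≤ f β}

/-- No cancellation occurs, so the inversions of `u * v` are those of `v` together with the
preimages under `v` of those of `u`. Only `v` has to respect the roots; `u` may be any automorphism,
for instance `-1`. -/
theorem inversions_mul (hR : C.IsRootSystem R) (hfin : ∀ a, (R a).Finite) {S : Set I} {b c : A}
    {u v : (I → ℤ) ≃ₗ[ℤ] (I → ℤ)} (hv : ∀ β, v β ∈ R c ↔ β ∈ R b)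
    (hS : ∀ β, ∀ k ∉ S, v β k = β k) (hu : ∀ β ∈ posRoots R S c, ¬ 0 ≤ v⁻¹ β → 0 ≤ u β) :
    (inversions R S b (u * v)).ncard = (inversions R S c u).ncard + (inversions R S b v).ncard := by
  have hvv : ∀ β, v (v⁻¹ β) = β := fun β => LinearEquiv.congr_fun (mul_inv_cancel v) β
  have hvv' : ∀ β, v⁻¹ (v β) = β := fun β => LinearEquiv.congr_fun (inv_mul_cancel v) β
  have key : inversions R S b (u * v) = ((fun β => v⁻¹ β) '' inversions R S c u) ∪ inversions R S b v := by
    ext γ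
    constructor
    · rintro ⟨⟨h1, h2, h3⟩, h4⟩
      by_cases h5 : 0 ≤ v γ
      · exact Or.inl ⟨v γ, ⟨⟨(hv γ).2 h1, h5, fun k hk => (hS γ k hk).trans (h3 k hk)⟩, h4⟩, hvv' γ⟩
      · exact Or.inr ⟨⟨h1, h2, h3⟩, h5⟩
    · rintro (⟨β, ⟨⟨h1, h2, h3⟩, h4⟩, rfl⟩ | ⟨⟨h1, h2, h3⟩, h4⟩)
      · refine ⟨⟨(hv _).1 (by rwa [hvv]), ?_, fun k hk => ?_⟩, ?_⟩
        · by_contra hn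
          exact h4 (hu β ⟨h1, h2, h3⟩ hn)
        · dsimp only
          rw [← hS (v⁻¹ β) k hk, hvv, h3 k hk]
        · rwa [LinearEquiv.mul_apply, hvv]
      · refine ⟨⟨h1, h2, h3⟩, fun h => ?_⟩
        have hvγ := (hv γ).2 h1
        -- Here `v γ` is negative, and `v⁻¹` makes the positive root `-v γ` negative, so `u` keeps
        -- it positive.
        have h5 := hu (-v γ) ⟨hR.neg_mem hvγ, (hR.nonneg_or hvγ).resolve_left h4,
          fun k hk => by rw [Pi.neg_apply, hS γ k hk, h3 k hk, neg_zero]⟩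
          (by rw [map_neg, hvv']; exact not_nonneg_neg h2 (hR.ne_zero h1))
        rw [map_neg] at h5
        refine not_nonneg_neg h ?_ h5
        simpa using hR.ne_zero h1
  rw [key, Set.ncard_union_eq ?_ (((hfin c).subset fun β h => h.1.1).image _)
    ((hfin b).subset fun β h => h.1.1), Set.ncard_image_of_injective _ (v⁻¹).injective]
  rw [Set.disjoint_left]
  rintro _ ⟨β, h, rfl⟩ h'
  exact h'.2 (by dsimp only; rw [hvv]; exact h.1.2.1)

theorem inversions_σ (hR : C.IsRootSystem R) {S : Set I} (b : A) {k : I} (hk : k ∈ S) :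
    inversions R S b (C.σ k b) = {α k} := by
  ext β
  constructor
  · rintro ⟨⟨h1, h2, h3⟩, h4⟩
    by_contra hn
    exact h4 (hR.σ_nonneg h1 h2 hn)
  · rintro rfl
    refine ⟨⟨hR.α_mem b k, α_nonneg k, fun l hl => ?_⟩, ?_⟩
    · have : l ≠ k := by rintro rfl; exact hl hk
      simp [α, this]
    · rw [σ_α_self]
      exact not_nonneg_neg (α_nonneg k) (hR.ne_zero (hR.α_mem b k))

theorem inversions_mul_σ (hR : C.IsRootSystem R) (hfin : ∀ a, (R a).Finite) {S : Set I} {b : A}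
    {f : (I → ℤ) ≃ₗ[ℤ] (I → ℤ)} {k : I} (hk : k ∈ S) (hf : 0 ≤ f (α k)) :
    (inversions R S (C.ρ k b) (f * C.σ k b)).ncard = (inversions R S b f).ncard + 1 := by
  rw [inversions_mul hR hfin (c := b) (fun β => hR.σ_mem_iff k), ← σ_ρ, inversions_σ hR _ hk,
    Set.ncard_singleton]
  · intro β l hl
    exact σ_apply_of_ne C (by rintro rfl; exact hl hk) b β
  · intro β hβ h
    rw [σ_inv] at h
    by_cases hβk : β = α k
    · rwa [hβk]
    · exact absurd (hR.σ_nonneg hβ.1 hβ.2.1 hβk) h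

/-- The map `-1` inverts every positive root and `-σ_k` all but `α k`. Counting the inversions of
`-1 = (-σ_k) σ_k` compares the two objects. -/
theorem ncard_posRoots_ρ (hR : C.IsRootSystem R) (hfin : ∀ a, (R a).Finite) {S : Set I} (b : A)
    {k : I} (hk : k ∈ S) : (posRoots R S (C.ρ k b)).ncard = (posRoots R S b).ncard := by
  have hα : ∀ a, α k ∈ posRoots R S a := fun a => by
    have : α k ∈ inversions R S a (C.σ k a) := by rw [inversions_σ hR a hk]; rfl
    exact this.1
  have h1 := inversions_mul_σ (f := LinearEquiv.neg ℤ * C.σ k b) hR hfin (b := b) hk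
    (by simp [σ_α_self, α_nonneg])
  have h2 : ∀ a, inversions R S a (LinearEquiv.neg ℤ) = posRoots R S a := fun a => by
    ext β
    exact ⟨fun h => h.1, fun h => ⟨h, not_nonneg_neg h.2.1 (hR.ne_zero h.1)⟩⟩
  have h3 : inversions R S b (LinearEquiv.neg ℤ * C.σ k b) = posRoots R S b \ {α k} := by
    ext β
    constructor
    · rintro ⟨h, h'⟩
      refine ⟨h, ?_⟩
      rintro rfl
      exact h' (by simp [σ_α_self, α_nonneg])
    · rintro ⟨h, h'⟩
      exact ⟨h, not_nonneg_neg (hR.σ_nonneg h.1 h.2.1 h') (hR.ne_zero (hR.σ_mem k h.1))⟩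
  rw [mul_assoc, σ_mul_σ, mul_one, h2, h3, Set.ncard_sdiff_singleton_add_one (hα b)
    ((hfin b).subset fun β h => h.1)] at h1
  exact h1

/-- A map which sends simple roots in `S` to negative roots inverts all positive roots with support
in `S`. -/
theorem ncard_inversions_of_nonpos (hR : C.IsRootSystem R) {S : Set I} {b c : A}
    {v : (I → ℤ) ≃ₗ[ℤ] (I → ℤ)} (hv : ∀ β, v β ∈ R c ↔ β ∈ R b)
    (hS : ∀ β, ∀ k ∉ S, v β k = β k) (hneg : ∀ k ∈ S, 0 ≤ -v (α k)) :
    (inversions R S b v).ncard = (posRoots R S c).ncard := by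
  have hvv : ∀ β, v (v⁻¹ β) = β := fun β => LinearEquiv.congr_fun (mul_inv_cancel v) β
  have h0 : ∀ β, 0 ≤ β → (∀ k ∉ S, β k = 0) → 0 ≤ -v β := by
    intro β h h'
    rw [map_eq_sum_α, ← Finset.sum_neg_distrib]
    refine Finset.sum_nonneg fun k _ => ?_
    by_cases hk : k ∈ S
    · rw [← smul_neg]
      exact smul_nonneg (h k) (hneg k hk)
    · simp [h' k hk]
  have : posRoots R S c = (fun β => -v β) '' inversions R S b v := by
    ext γ
    constructor
    · rintro ⟨h1, h2, h3⟩
      have h1' : -v⁻¹ γ ∈ R b := hR.neg_mem ((hv _).1 (by rwa [hvv]))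
      have h3' : ∀ k ∉ S, (v⁻¹ γ) k = 0 := fun k hk => by
        rw [← hS (v⁻¹ γ) k hk, hvv, h3 k hk]
      refine ⟨-v⁻¹ γ, ⟨⟨h1', ?_, fun k hk => by
        rw [Pi.neg_apply, h3' k hk, neg_zero]⟩, ?_⟩, ?_⟩
      · refine (hR.nonneg_or h1').resolve_right fun h => ?_
        rw [neg_neg] at h
        have := h0 _ h h3'
        rw [hvv] at this
        exact not_nonneg_neg h2 (hR.ne_zero h1) this
      · rw [map_neg, hvv]
        exact not_nonneg_neg h2 (hR.ne_zero h1)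
      · dsimp only
        rw [map_neg, hvv, neg_neg]
    · rintro ⟨β, ⟨⟨h1, h2, h3⟩, h4⟩, rfl⟩
      exact ⟨hR.neg_mem ((hv _).2 h1), h0 β h2 h3, fun k hk => by simp [hS _ k hk, h3 k hk]⟩
  rw [this, Set.ncard_image_of_injective]
  exact fun x y h => v.injective (neg_injective h)

/-- By cardinality, `-v` maps the inversions onto all positive roots at `c` supported in `S`. If `v
(α k)` were positive, it would be the image of `-α k`, which is not positive. -/
theorem nonneg_neg_of_ncard_inversions (hR : C.IsRootSystem R) (hfin : ∀ a, (R a).Finite)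
    {S : Set I} {b c : A} {v : (I → ℤ) ≃ₗ[ℤ] (I → ℤ)} (hv : ∀ β, v β ∈ R c ↔ β ∈ R b)
    (hS : ∀ β, ∀ k ∉ S, v β k = β k)
    (hcard : (inversions R S b v).ncard = (posRoots R S c).ncard) :
    ∀ k ∈ S, 0 ≤ -v (α k) := by
  have hinj : Function.Injective fun β => -v β := fun x y h => v.injective (neg_injective h)
  have hsub : (fun β => -v β) '' inversions R S b v ⊆ posRoots R S c := by
    rintro _ ⟨β, ⟨⟨h1, h2, h3⟩, h4⟩, rfl⟩
    exact ⟨hR.neg_mem ((hv _).2 h1), (hR.nonneg_or ((hv _).2 h1)).resolve_left h4,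
      fun k hk => by simp [hS _ k hk, h3 k hk]⟩
  have heq := Set.eq_of_subset_of_ncard_le hsub
    (by rw [Set.ncard_image_of_injective _ hinj, hcard]) ((hfin c).subset fun β h => h.1)
  intro k hk
  have hα := (hv _).2 (hR.α_mem b k)
  refine (hR.nonneg_or hα).resolve_left fun h => ?_
  have hmem : v (α k) ∈ posRoots R S c := ⟨hα, h, fun l hl => by
    have : l ≠ k := by rintro rfl; exact hl hk
    rw [hS _ l hl]
    simp [α, this]⟩
  rw [← heq] at hmem
  obtain ⟨β, hβ, hβ'⟩ := hmem
  have : β = -α k := v.injective (by rw [map_neg, ← hβ', neg_neg])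
  exact not_nonneg_neg (α_nonneg k) (hR.ne_zero (hR.α_mem b k)) (this ▸ hβ.1.2.1)

/-- The difference `x = f (α l) - α l` is supported in `S`, hence fixed by `f`. The iterates `α l +
t • x` all stay in the finite set `T`, so `x = 0`. -/
theorem eq_one_of_unipotent {T : Set (I → ℤ)} (hT : T.Finite) (hα : ∀ k, α k ∈ T) {S : Set I}
    {f : (I → ℤ) ≃ₗ[ℤ] (I → ℤ)} (hf : ∀ β ∈ T, f β ∈ T) (hS : ∀ β, ∀ k ∉ S, f β k = β k)
    (hfix : ∀ k ∈ S, f (α k) = α k) : f = 1 := by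
  have hfix' : ∀ v : I → ℤ, (∀ k ∉ S, v k = 0) → f v = v := by
    intro v hv
    rw [map_eq_sum_α]
    conv_rhs => rw [eq_sum_α v]
    refine Finset.sum_congr rfl fun k _ => ?_
    by_cases hk : k ∈ S
    · rw [hfix k hk]
    · simp [hv k hk]
  have hbasis : ∀ l, f (α l) = α l := by
    intro l
    by_contra hne
    set x := f (α l) - α l with hx
    have hx0 : x ≠ 0 := sub_ne_zero.2 hne
    have hfx : f x = x := hfix' x fun k hk => by simp [hx, hS _ k hk]
    have hmem : ∀ t : ℕ, α l + t • x ∈ T := by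
      intro t
      induction t with
      | zero => simpa using hα l
      | succ t ih =>
        have := hf _ ih
        rw [map_add, map_nsmul, hfx] at this
        have h2 : f (α l) + t • x = α l + (t + 1) • x := by
          rw [add_smul, one_smul, hx]
          abel
        rwa [h2] at this
    refine Set.infinite_of_injective_forall_mem (f := fun t : ℕ => α l + t • x) ?_ hmem hT
    intro s t hst
    obtain ⟨k, hk⟩ := Function.ne_iff.1 hx0
    have := congrFun (add_left_cancel hst) k
    have hk' : x k ≠ 0 := hk
    simpa [hk'] using this
  ext1 v
  rw [map_eq_sum_α]
  simp_rw [hbasis]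
  exact (eq_sum_α v).symm

end Roots

/-! ### Alternating words and the rank-two Coxeter relations. -/

/-- Right multiplication of the pair `(b, f)`, where `f` starts at `b`, by the simple reflection
which ends at `b`. -/
def step (C : CartanScheme I A) (k : I) (x : A × ((I → ℤ) ≃ₗ[ℤ] (I → ℤ))) :
    A × ((I → ℤ) ≃ₗ[ℤ] (I → ℤ)) :=
  (C.ρ k x.1, x.2 * C.σ k x.1)

theorem step_step (C : CartanScheme I A) (k : I) (x : A × ((I → ℤ) ≃ₗ[ℤ] (I → ℤ))) :
    C.step k (C.step k x) = x := by
  simp [step, C.ρ_ρ, σ_ρ, mul_assoc, σ_mul_σ]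

theorem step_snd_α (C : CartanScheme I A) (k : I) (x : A × ((I → ℤ) ≃ₗ[ℤ] (I → ℤ))) :
    (C.step k x).2 (α k) = -x.2 (α k) := by
  simp [step, σ_α_self]

/-- The `t`-th letter of the word `i, j, i, j, …`. -/
def letter (i j : I) (t : ℕ) : I := if Even t then i else j

theorem letter_succ (i j : I) (t : ℕ) : letter i j (t + 1) = letter j i t := by
  simp only [letter, Nat.even_add_one]
  split_ifs <;> rfl

theorem letter_mem (i j : I) (t : ℕ) : letter i j t ∈ ({i, j} : Set I) := by
  simp only [letter]
  split_ifs <;> simp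

theorem eq_letter_or (i j : I) (t : ℕ) {k : I} (hk : k ∈ ({i, j} : Set I)) :
    k = letter i j t ∨ k = letter j i t := by
  simp only [letter]
  rcases hk with rfl | rfl <;> split_ifs <;> simp

/-- `t` steps along the word `i, j, i, j, …`. -/
def walk (C : CartanScheme I A) (i j : I) :
    ℕ → A × ((I → ℤ) ≃ₗ[ℤ] (I → ℤ)) → A × ((I → ℤ) ≃ₗ[ℤ] (I → ℤ))
  | 0, x => x
  | t + 1, x => C.step (letter i j t) (C.walk i j t x)

theorem walk_mul (C : CartanScheme I A) (i j : I) (t : ℕ) (b : A)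
    (g f : (I → ℤ) ≃ₗ[ℤ] (I → ℤ)) :
    C.walk i j t (b, g * f) = ((C.walk i j t (b, f)).1, g * (C.walk i j t (b, f)).2) := by
  induction t with
  | zero => rfl
  | succ t ih => simp [walk, ih, step, mul_assoc]

theorem walk_eq (C : CartanScheme I A) (i j : I) (t : ℕ) (b : A) (f : (I → ℤ) ≃ₗ[ℤ] (I → ℤ)) :
    C.walk i j t (b, f) = ((C.walk i j t (b, 1)).1, f * (C.walk i j t (b, 1)).2) := by
  rw [← walk_mul, mul_one]

theorem walk_succ' (C : CartanScheme I A) (i j : I) (t : ℕ) (x : A × ((I → ℤ) ≃ₗ[ℤ] (I → ℤ))) :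
    C.walk i j (t + 1) x = C.walk j i t (C.step i x) := by
  induction t with
  | zero => simp [walk, letter]
  | succ t ih =>
    rw [walk, ih, letter_succ]
    rfl

section Roots

variable [Nonempty I] {C : CartanScheme I A} {R : A → Set (I → ℤ)}

/-- `x = (b, f)` where `f` maps `R b` onto `R c` and is the identity modulo the span of the `α_k`
with `k ∈ S`. -/
def IsRootMap (R : A → Set (I → ℤ)) (S : Set I) (c : A) (x : A × ((I → ℤ) ≃ₗ[ℤ] (I → ℤ))) : Prop :=
  (∀ β, x.2 β ∈ R c ↔ β ∈ R x.1) ∧ ∀ β, ∀ k ∉ S, x.2 β k = β k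

theorem isRootMap_one (S : Set I) (c : A) : IsRootMap R S c (c, 1) :=
  ⟨fun _ => Iff.rfl, fun _ _ _ => rfl⟩

theorem IsRootMap.step (hR : C.IsRootSystem R) {S : Set I} {c : A}
    {x : A × ((I → ℤ) ≃ₗ[ℤ] (I → ℤ))} (hx : IsRootMap R S c x) {k : I} (hk : k ∈ S) :
    IsRootMap R S c (C.step k x) := by
  refine ⟨fun β => (hx.1 _).trans (hR.σ_mem_iff k), fun β l hl => ?_⟩
  have : l ≠ k := by rintro rfl; exact hl hk
  exact (hx.2 _ l hl).trans (σ_apply_of_ne C this _ _)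

theorem isRootMap_walk (hR : C.IsRootSystem R) (i j : I) (t : ℕ) (b : A) :
    IsRootMap R {i, j} b (C.walk i j t (b, 1)) := by
  induction t with
  | zero => exact isRootMap_one _ _
  | succ t ih => exact ih.step hR (letter_mem i j t)

/-- The letter just used is a descent. If the next one were a descent too, all rank-two positive
roots would be inverted, which is too many before the walk has reached full length. -/
theorem ncard_inversions_walk (hR : C.IsRootSystem R) (hfin : ∀ a, (R a).Finite) (i j : I) (b : A)
    (t : ℕ) (ht : t ≤ (posRoots R {i, j} b).ncard) :
    (inversions R {i, j} (C.walk i j t (b, 1)).1 (C.walk i j t (b, 1)).2).ncard = t ∧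
    (t < (posRoots R {i, j} b).ncard → 0 ≤ (C.walk i j t (b, 1)).2 (α (letter i j t))) := by
  induction t with
  | zero =>
    refine ⟨?_, fun _ => α_nonneg _⟩
    rw [Set.ncard_eq_zero ((hfin _).subset fun β h => h.1.1)]
    exact Set.eq_empty_of_forall_notMem fun β h => h.2 h.1.2.1
  | succ t ih =>
    obtain ⟨h1, h2⟩ := ih (by omega)
    have h3 : (inversions R {i, j} (C.walk i j (t + 1) (b, 1)).1
        (C.walk i j (t + 1) (b, 1)).2).ncard = t + 1 :=
      (inversions_mul_σ hR hfin (letter_mem i j t) (h2 (by omega))).trans (by rw [h1])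
    refine ⟨h3, fun hlt => ?_⟩
    have hm := isRootMap_walk hR i j (t + 1) b
    by_contra hn
    rw [ncard_inversions_of_nonpos hR hm.1 hm.2] at h3
    · omega
    · intro k hk
      rcases eq_letter_or i j t hk with rfl | rfl
      · rw [walk, step_snd_α, neg_neg]
        exact h2 (by omega)
      · rw [letter_succ] at hn
        exact (hR.nonneg_or ((hm.1 _).2 (hR.α_mem _ _))).resolve_left hn

theorem walk_α_nonpos (hR : C.IsRootSystem R) (hfin : ∀ a, (R a).Finite) (i j : I) (b : A) {k : I}
    (hk : k ∈ ({i, j} : Set I)) :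
    0 ≤ -(C.walk i j (posRoots R {i, j} b).ncard (b, 1)).2 (α k) := by
  have hm := isRootMap_walk hR i j (posRoots R {i, j} b).ncard b
  exact nonneg_neg_of_ncard_inversions hR hfin hm.1 hm.2
    (ncard_inversions_walk hR hfin i j b _ le_rfl).1 k hk

/-- Prepending `σ_j` to this walk, one step short of full length, gives a full-length walk, which
makes both simple roots negative. So `σ_j` sends the positive root in question to a negative one,
and that root can only be `α j`. -/
theorem walk_pred_α (hR : C.IsRootSystem R) (hfin : ∀ a, (R a).Finite) {i j : I} {b : A} {m : ℕ}
    (hm : (posRoots R {i, j} b).ncard = m + 1) :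
    (C.walk i j m (b, 1)).2 (α (letter i j m)) = α j := by
  have h0 := (ncard_inversions_walk (C := C) hR hfin i j b m (by omega)).2 (by omega)
  have hmem := ((isRootMap_walk hR i j m b).1 _).2 (hR.α_mem _ (letter i j m))
  by_contra hne
  have h1 := hR.σ_nonneg hmem h0 hne
  have hM : (posRoots R {j, i} (C.ρ j b)).ncard = m + 1 := by
    rw [Set.pair_comm, ncard_posRoots_ρ hR hfin b (by simp), hm]
  have h2 := walk_α_nonpos (C := C) hR hfin j i (C.ρ j b)
    (by rw [Set.pair_comm]; exact letter_mem i j m)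
  rw [hM, walk_succ', CartanScheme.step, walk_eq] at h2
  simp only [C.ρ_ρ, σ_ρ, one_mul, LinearEquiv.mul_apply] at h2
  exact not_nonneg_neg h1 (hR.ne_zero (hR.σ_mem j hmem)) h2

theorem walk_ncard_α (hR : C.IsRootSystem R) (hfin : ∀ a, (R a).Finite) {i j : I} {b : A} {m : ℕ}
    (hm : (posRoots R {i, j} b).ncard = m + 1) :
    (C.walk i j (m + 1) (b, 1)).2 (α (letter i j m)) = -α j ∧
    (C.walk i j (m + 1) (b, 1)).2 (α (letter j i m)) = -α i := by
  constructor
  · rw [walk, step_snd_α, walk_pred_α hR hfin hm]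
  · have hM : (posRoots R {j, i} (C.ρ i b)).ncard = m + 1 := by
      rw [Set.pair_comm, ncard_posRoots_ρ hR hfin b (by simp), hm]
    rw [walk_succ', CartanScheme.step, walk_eq]
    simp only [one_mul, LinearEquiv.mul_apply]
    rw [walk_pred_α hR hfin hM, σ_α_self]

theorem walk_fst_double (C : CartanScheme I A) (i j : I) (m : ℕ) (b : A) :
    (C.walk j i (2 * m) (b, 1)).1 = (fun b => C.ρ i (C.ρ j b))^[m] b := by
  induction m with
  | zero => rfl
  | succ m ih =>
    rw [Function.iterate_succ_apply', ← ih, show 2 * (m + 1) = 2 * m + 1 + 1 by ring, walk, walk]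
    simp [CartanScheme.step, letter]

/-- The `2 * n` steps form a closed cycle of objects, and the two walks traverse it in opposite
directions. -/
theorem walk_fst_of_double (C : CartanScheme I A) (i j : I) (n : ℕ) (b : A)
    (h : (C.walk j i (2 * n) (b, 1)).1 = b) (t : ℕ) (ht : t ≤ 2 * n) :
    (C.walk i j t (b, 1)).1 = (C.walk j i (2 * n - t) (b, 1)).1 := by
  induction t with
  | zero => exact h.symm
  | succ t ih =>
    obtain ⟨s, hs⟩ : ∃ s, 2 * n - t = s + 1 := ⟨2 * n - t - 1, by omega⟩
    have h1 := ih (by omega)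
    have h2 : 2 * n - (t + 1) = s := by omega
    have h3 : letter i j t = letter j i s := by
      have : Even t ↔ ¬ Even s := by
        have h4 : t + (s + 1) = 2 * n := by omega
        rw [← Nat.even_add_one, ← Nat.even_add, h4]
        exact even_two_mul n
      simp only [letter, this]
      split_ifs <;> rfl
    rw [hs, walk] at h1
    rw [h2, walk]
    simp only [CartanScheme.step] at h1 ⊢
    rw [h1, h3, C.ρ_ρ]

theorem posRoots_pair {i j : I} (hij : i ≠ j) (a : A) :
    R a ∩ {β | ∃ m n : ℕ, β = m • α i + n • α j} = posRoots R {i, j} a := by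
  ext β
  constructor
  · rintro ⟨h, m, n, rfl⟩
    refine ⟨h, add_nonneg (nsmul_nonneg (α_nonneg i) m) (nsmul_nonneg (α_nonneg j) n),
      fun k hk => ?_⟩
    simp only [Set.mem_insert_iff, Set.mem_singleton_iff, not_or] at hk
    simp [α, hk.1, hk.2]
  · rintro ⟨h, h0, hS⟩
    refine ⟨h, (β i).toNat, (β j).toNat, ?_⟩
    ext k
    by_cases hi : k = i
    · subst hi
      have := h0 k
      simp only [Pi.zero_apply] at this
      simp [α, hij, this]
    · by_cases hj : k = j
      · subst hj
        have := h0 k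
        simp only [Pi.zero_apply] at this
        simp [α, hi, this]
      · simp [α, hi, hj, hS k (by simp [hi, hj])]

theorem exists_ncard_posRoots_pair (hR : C.IsRootSystem R) (hfin : ∀ a, (R a).Finite) (i j : I)
    (b : A) : ∃ m, (posRoots R {i, j} b).ncard = m + 1 := by
  refine Nat.exists_eq_succ_of_ne_zero fun h => ?_
  rw [Set.ncard_eq_zero ((hfin b).subset fun β h => h.1)] at h
  have h1 : α i ∈ inversions R {i, j} b (C.σ i b) := by rw [inversions_σ hR b (by simp)]; rfl
  have h2 := h1.1
  rw [h] at h2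
  exact h2

/-- The Coxeter relations. -/
theorem walk_comm (hR : C.IsRootSystem R) (hfin : ∀ a, (R a).Finite) {i j : I} (hij : i ≠ j)
    (b : A) : C.walk i j (posRoots R {i, j} b).ncard (b, 1) =
      C.walk j i (posRoots R {i, j} b).ncard (b, 1) := by
  obtain ⟨m, hm⟩ := exists_ncard_posRoots_pair hR hfin i j b
  have hm' : (posRoots R {j, i} b).ncard = m + 1 := by rw [Set.pair_comm, hm]
  have hobj : (C.walk i j (m + 1) (b, 1)).1 = (C.walk j i (m + 1) (b, 1)).1 := by
    have h := hR.iterate_ρ b i j hij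
    rw [posRoots_pair hij, hm] at h
    have h' := walk_fst_of_double C i j (m + 1) b
      ((walk_fst_double C i j (m + 1) b).trans (h ((hfin b).subset fun β h => h.1)))
      (m + 1) (by omega)
    rwa [show 2 * (m + 1) - (m + 1) = m + 1 by omega] at h'
  rw [hm]
  obtain ⟨h1, h2⟩ := walk_ncard_α (C := C) hR hfin hm
  obtain ⟨h3, h4⟩ := walk_ncard_α (C := C) hR hfin hm'
  have r1 := isRootMap_walk hR i j (m + 1) b
  have r2 := isRootMap_walk hR j i (m + 1) b
  rw [Set.pair_comm] at r2
  set x := C.walk i j (m + 1) (b, 1)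
  set y := C.walk j i (m + 1) (b, 1)
  have hxx : ∀ β, x.2 (x.2⁻¹ β) = β := fun β => LinearEquiv.congr_fun (mul_inv_cancel x.2) β
  have hxx' : ∀ β, x.2⁻¹ (x.2 β) = β := fun β => LinearEquiv.congr_fun (inv_mul_cancel x.2) β
  -- Both full-length walks have the same values on `α i` and `α j` and are the identity modulo
  -- their span, so the quotient is unipotent.
  have hone : x.2⁻¹ * y.2 = 1 := by
    refine eq_one_of_unipotent (T := R x.1) (S := {i, j}) (hfin _) (hR.α_mem _) ?_ ?_ ?_
    · intro β hβ
      rw [← r1.1, LinearEquiv.mul_apply, hxx, r2.1, ← hobj]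
      exact hβ
    · intro β k hk
      rw [LinearEquiv.mul_apply, ← r1.2 (x.2⁻¹ (y.2 β)) k hk, hxx, r2.2 _ k hk]
    · intro k hk
      rw [LinearEquiv.mul_apply]
      rcases eq_letter_or i j m hk with rfl | rfl
      · rw [h4, ← h1, hxx']
      · rw [h3, ← h2, hxx']
  exact Prod.ext hobj (inv_mul_eq_one.1 hone)

/-! ### Ascending paths and the exchange property. -/

/-- The pair `x` is reached from `(a, 1)` by `n` steps each of which increases the length. -/
inductive Ascends (C : CartanScheme I A) (a : A) : ℕ → A × ((I → ℤ) ≃ₗ[ℤ] (I → ℤ)) → Prop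
  | base : Ascends C a 0 (a, 1)
  | step {n : ℕ} {x : A × ((I → ℤ) ≃ₗ[ℤ] (I → ℤ))} (k : I) (hx : Ascends C a n x)
      (hk : 0 ≤ x.2 (α k)) : Ascends C a (n + 1) (C.step k x)

theorem Ascends.isRootMap (hR : C.IsRootSystem R) {a : A} {n : ℕ}
    {x : A × ((I → ℤ) ≃ₗ[ℤ] (I → ℤ))} (h : Ascends C a n x) : IsRootMap R Set.univ a x := by
  induction h with
  | base => exact isRootMap_one _ _
  | step k _ _ ih => exact ih.step hR (Set.mem_univ k)

theorem Ascends.ncard_inversions (hR : C.IsRootSystem R) (hfin : ∀ a, (R a).Finite) {a : A} {n : ℕ}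
    {x : A × ((I → ℤ) ≃ₗ[ℤ] (I → ℤ))} (h : Ascends C a n x) :
    (inversions R Set.univ x.1 x.2).ncard = n := by
  induction h with
  | base =>
    rw [Set.ncard_eq_zero ((hfin _).subset fun β h => h.1.1)]
    exact Set.eq_empty_of_forall_notMem fun β h => h.2 h.1.2.1
  | step k _ hk ih =>
    rw [CartanScheme.step, inversions_mul_σ hR hfin (Set.mem_univ k) hk, ih]

/-- Before full length, the walk from the identity sends its next simple root to a nonnegative
combination of `α p` and `α q`, and `x` makes both of these negative. -/
theorem walk_descent (hR : C.IsRootSystem R) (hfin : ∀ a, (R a).Finite) {p q : I}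
    {x : A × ((I → ℤ) ≃ₗ[ℤ] (I → ℤ))} (hp : 0 ≤ -x.2 (α p))
    (hq : 0 ≤ -x.2 (α q)) {t : ℕ} (ht : t < (posRoots R {p, q} x.1).ncard) :
    0 ≤ -(C.walk p q t x).2 (α (letter p q t)) := by
  obtain ⟨b, f⟩ := x
  have h := (ncard_inversions_walk (C := C) hR hfin p q b t ht.le).2 ht
  have hm := isRootMap_walk hR p q t b
  rw [walk_eq, LinearEquiv.mul_apply, map_eq_sum_α f, ← Finset.sum_neg_distrib]
  refine Finset.sum_nonneg fun k _ => ?_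
  rw [← smul_neg]
  by_cases hk : k ∈ ({p, q} : Set I)
  · refine smul_nonneg (h k) ?_
    rcases hk with rfl | rfl
    exacts [hp, hq]
  · have : k ≠ letter p q t := by rintro rfl; exact hk (letter_mem p q t)
    rw [hm.2 _ k hk]
    simp [α, this]

/-- Strong induction on `n`. If the last letter `i` differs from `j`, both are descents of `x`. The
alternating walk starting with `i` descends to the bottom of the rank-two cycle, by the induction
hypothesis. By the Coxeter relation, the walk starting with `j` ends at the same bottom, and
climbing back along it arrives at `C.step j x`. -/
theorem Ascends.exchange (hR : C.IsRootSystem R) (hfin : ∀ a, (R a).Finite) {a : A} {n : ℕ}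
    {x : A × ((I → ℤ) ≃ₗ[ℤ] (I → ℤ))} (h : Ascends C a n x) {j : I} (hj : ¬ 0 ≤ x.2 (α j)) :
    ∃ m, n = m + 1 ∧ Ascends C a m (C.step j x) := by
  induction n using Nat.strong_induction_on generalizing x j with
  | _ n ih =>
  have hx := h.isRootMap hR
  cases h with
  | base => exact absurd (α_nonneg j) hj
  | @step m y i hy hi =>
  by_cases hij : i = j
  · subst hij
    exact ⟨m, rfl, by rwa [step_step]⟩
  refine ⟨m, rfl, ?_⟩
  have hy' : Ascends C a m (C.step i (C.step i y)) := by rwa [step_step]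
  have hxi : 0 ≤ -(C.step i y).2 (α i) := by rwa [step_snd_α, neg_neg]
  clear hi hy
  generalize C.step i y = x at *
  have hxj : 0 ≤ -x.2 (α j) :=
    (hR.nonneg_or ((hx.1 _).2 (hR.α_mem _ j))).resolve_left hj
  obtain ⟨M, hM⟩ := exists_ncard_posRoots_pair hR hfin i j x.1
  have hM' : (posRoots R {j, i} x.1).ncard = M + 1 := by rw [Set.pair_comm, hM]
  have hdown : ∀ t ≤ M, ∃ r, r + t = m ∧ Ascends C a r (C.walk i j (t + 1) x) := by
    intro t ht
    induction t with
    | zero => exact ⟨m, rfl, hy'⟩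
    | succ t iht =>
      obtain ⟨r, hr, hasc⟩ := iht (by omega)
      have h1 := walk_descent hR hfin hxi hxj (t := t + 1) (by omega)
      obtain ⟨r', rfl, h2⟩ := ih r (by omega) hasc (j := letter i j (t + 1)) fun h0 =>
        not_nonneg_neg h0 (hR.ne_zero (((hasc.isRootMap hR).1 _).2 (hR.α_mem _ _))) h1
      exact ⟨r', by omega, h2⟩
  obtain ⟨r, hr, hbot⟩ := hdown M le_rfl
  -- The climb stops at `s = M`, one step below `x` on the `j` side, after `r + M = m` ascents in
  -- total.
  have hup : ∀ s ≤ M, Ascends C a (r + s) (C.walk j i (M - s + 1) x) := by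
    intro s hs
    induction s with
    | zero =>
      have := walk_comm hR hfin hij x.1
      rw [hM] at this
      rwa [← Prod.mk.eta (p := x), walk_eq, Nat.sub_zero, ← this, ← walk_eq]
    | succ s ihs =>
      have h1 := ihs (by omega)
      rw [show M - s = M - (s + 1) + 1 by omega, walk] at h1
      have h2 := walk_descent hR hfin hxj hxi (t := M - (s + 1) + 1) (by omega)
      have h3 := h1.step (letter j i (M - (s + 1) + 1)) (by rwa [step_snd_α])
      rwa [step_step] at h3
  have h := hup M le_rfl
  rw [Nat.sub_self, add_comm r, add_comm M] at h
  rwa [hr] at h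

end Roots

/-! ### Length equals the number of inversions. -/

section Length

variable [Nonempty I] {C : CartanScheme I A} {R : A → Set (I → ℤ)}

theorem exists_ascends_wordMap (hR : C.IsRootSystem R) (hfin : ∀ a, (R a).Finite) (l : List I)
    (b : A) : ∃ n, Ascends C (C.wordObj l b) n (b, C.wordMap l b) := by
  induction l using List.reverseRecOn generalizing b with
  | nil => exact ⟨0, Ascends.base⟩
  | append_singleton l k ih =>
    obtain ⟨n, hn⟩ := ih (C.ρ k b)
    have hstep : C.step k (C.ρ k b, C.wordMap l (C.ρ k b)) = (b, C.wordMap (l ++ [k]) b) := by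
      simp [step, C.ρ_ρ, σ_ρ, wordMap_append, wordMap, wordObj]
    have hobj : C.wordObj (l ++ [k]) b = C.wordObj l (C.ρ k b) := wordObj_append C l [k] b
    rw [hobj, ← hstep]
    by_cases hk : 0 ≤ C.wordMap l (C.ρ k b) (α k)
    · exact ⟨n + 1, hn.step k hk⟩
    · obtain ⟨m, -, hm⟩ := hn.exchange hR hfin hk
      exact ⟨m, hm⟩

theorem Ascends.exists_word {a : A} {n : ℕ} {x : A × ((I → ℤ) ≃ₗ[ℤ] (I → ℤ))}
    (h : Ascends C a n x) :
    ∃ l : List I, l.length = n ∧ C.wordObj l x.1 = a ∧ C.wordMap l x.1 = x.2 := by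
  induction h with
  | base => exact ⟨[], rfl, rfl, rfl⟩
  | @step n x k _ _ ih =>
    obtain ⟨l, h1, h2, h3⟩ := ih
    refine ⟨l ++ [k], by simp [h1], ?_, ?_⟩
    · simp [wordObj_append, wordObj, CartanScheme.step, C.ρ_ρ, h2]
    · simp [wordMap_append, wordMap, wordObj, CartanScheme.step, C.ρ_ρ, σ_ρ, h3]

theorem ncard_inversions_wordMap_le (hR : C.IsRootSystem R) (hfin : ∀ a, (R a).Finite)
    (l : List I) (b : A) :
    (inversions R Set.univ b (C.wordMap l b)).ncard ≤ l.length := by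
  induction l using List.reverseRecOn generalizing b with
  | nil =>
    refine le_of_eq ((Set.ncard_eq_zero ((hfin _).subset fun β h => h.1.1)).2 ?_)
    exact Set.eq_empty_of_forall_notMem fun β h => h.2 h.1.2.1
  | append_singleton l k ih =>
    have h1 : C.wordMap (l ++ [k]) b = C.wordMap l (C.ρ k b) * C.σ k (C.ρ k b) := by
      simp [σ_ρ, wordMap_append, wordMap, wordObj]
    have h2 := ih (C.ρ k b)
    rw [List.length_append, List.length_singleton]
    obtain ⟨n, hn⟩ := exists_ascends_wordMap hR hfin l (C.ρ k b)
    rcases hR.nonneg_or (((hn.isRootMap hR).1 (α k)).2 (hR.α_mem _ k)) with h | h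
    · have := inversions_mul_σ (b := C.ρ k b) (f := C.wordMap l (C.ρ k b)) hR hfin
        (Set.mem_univ k) h
      rw [C.ρ_ρ, ← h1] at this
      omega
    -- When `k` is a descent of the shorter word, the roles swap: appending `k` to the longer word
    -- gives back the shorter map with one more inversion.
    · have := inversions_mul_σ (b := b) (f := C.wordMap (l ++ [k]) b) hR hfin (Set.mem_univ k)
        (by rw [h1, LinearEquiv.mul_apply, σ_α_self, map_neg]; exact h)
      rw [h1, mul_assoc, σ_ρ, σ_mul_σ, mul_one, ← σ_ρ, ← h1] at this
      omega

theorem exists_ascends (hR : C.IsRootSystem R) (hfin : ∀ a, (R a).Finite) {b c : WeylGroupoid C}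
    (f : b ⟶ c) : ∃ n, Ascends C c.obj n (b.obj, toAut f) := by
  obtain ⟨l, hl, hf⟩ := WeylHom.exists_word f
  have := exists_ascends_wordMap hR hfin l b.obj
  rwa [hl, hf] at this

/-- An ascending path provides a word of exactly this length, and each letter of an arbitrary word
adds at most one inversion. -/
theorem len_eq_ncard (hR : C.IsRootSystem R) (hfin : ∀ a, (R a).Finite) {b c : WeylGroupoid C}
    (f : b ⟶ c) : len f = (inversions R Set.univ b.obj (toAut f)).ncard := by
  obtain ⟨n, hn⟩ := exists_ascends hR hfin f
  obtain ⟨l, h1, h2, h3⟩ := hn.exists_word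
  have hmem : (inversions R Set.univ b.obj (toAut f)).ncard ∈ {k | ∃ l : List I, l.length = k ∧
      C.wordObj l b.obj = c.obj ∧ C.wordMap l b.obj = toAut f} :=
    ⟨l, by rw [h1, ← hn.ncard_inversions hR hfin], h2, h3⟩
  refine le_antisymm (Nat.sInf_le hmem) (le_csInf ⟨_, hmem⟩ ?_)
  rintro _ ⟨m, rfl, -, hm⟩
  rw [← hm]
  exact ncard_inversions_wordMap_le hR hfin m _

/-- The identity map has no inversions, so its ascending path is empty and both ends coincide. -/
theorem obj_eq_of_toAut_eq_one (hR : C.IsRootSystem R) (hfin : ∀ a, (R a).Finite)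
    {b c : WeylGroupoid C} {f : b ⟶ c} (hf : toAut f = 1) : b = c := by
  obtain ⟨n, hn⟩ := exists_ascends hR hfin f
  have h0 := hn.ncard_inversions hR hfin
  rw [hf, (Set.ncard_eq_zero ((hfin _).subset fun β h => h.1.1)).2
    (Set.eq_empty_of_forall_notMem fun β h => h.2 h.1.2.1)] at h0
  subst h0
  rw [hf] at hn
  obtain ⟨b⟩ := b
  obtain ⟨c⟩ := c
  cases hn
  rfl

theorem homTo_eq_of_toAut_eq_one (hR : C.IsRootSystem R) (hfin : ∀ a, (R a).Finite) {a : A}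
    {u w : C.HomTo a} {v : u.1 ⟶ w.1} (h : u.2 = v ≫ w.2) (hv : toAut v = 1) : u = w := by
  obtain ⟨b, f⟩ := u
  obtain ⟨c, g⟩ := w
  obtain rfl : b = c := obj_eq_of_toAut_eq_one hR hfin hv
  have hfg : f = g := by
    refine WeylHom.ext ?_
    have h1 : toAut f = toAut g * toAut v := congrArg toAut h
    rwa [hv, mul_one] at h1
  rw [hfg]

theorem weakLE_of_comp (hR : C.IsRootSystem R) (hfin : ∀ a, (R a).Finite) {a : A}
    {u w : C.HomTo a} (v : w.1 ⟶ u.1) (h : w.2 = v ≫ u.2)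
    (huv : ∀ β ∈ R u.1.obj, 0 ≤ β → ¬ 0 ≤ (toAut v)⁻¹ β → 0 ≤ toAut u.2 β) : WeakLE u w := by
  refine ⟨v, h, ?_⟩
  obtain ⟨n, hn⟩ := exists_ascends hR hfin v
  have hm := hn.isRootMap hR
  rw [len_eq_ncard hR hfin, len_eq_ncard hR hfin, len_eq_ncard hR hfin, h]
  exact (inversions_mul hR hfin hm.1 hm.2 fun β hβ => huv β hβ.1 hβ.2.1).symm

end Length

/-! ### Parabolic cosets and chambers. -/

section Cosets

variable {C : CartanScheme I A}

theorem toAut_inv {b c : WeylGroupoid C} (f : b ⟶ c) : toAut (Groupoid.inv f) = (toAut f)⁻¹ := rfl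

theorem id_mem_parabolic (J : Finset I) (b : WeylGroupoid C) :
    𝟙 b ∈ (C.parabolic J).arrows b b :=
  Subgroupoid.mem_sInf_arrows.2 fun _ hS => hS.1.wide b

theorem s_mem_parabolic {J : Finset I} {j : I} (hj : j ∈ J) (b : A) :
    C.s j b ∈ (C.parabolic J).arrows ⟨b⟩ ⟨C.ρ j b⟩ :=
  Subgroupoid.mem_sInf_arrows.2 fun _ hS => hS.2 j hj b

/-- The morphisms preserving the `k`-th coordinate form a wide subgroupoid containing the
generators. This invariant is all that is needed from parabolic membership. -/
theorem toAut_apply_of_mem_parabolic {J : Finset I} {b c : WeylGroupoid C} {v : b ⟶ c}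
    (hv : v ∈ (C.parabolic J).arrows b c) {k : I} (hk : k ∉ J) (β : I → ℤ) :
    toAut v β k = β k := by
  let S : Subgroupoid (WeylGroupoid C) :=
    { arrows := fun b c => {f | ∀ β, toAut f β k = β k}
      inv := by
        intro b c p hp β
        rw [toAut_inv, ← hp ((toAut p)⁻¹ β)]
        exact congrFun (LinearEquiv.congr_fun (mul_inv_cancel (toAut p)) β) k
      mul := by
        intro b c d p hp q hq β
        exact (hq _).trans (hp β) }
  refine Subgroupoid.mem_sInf_arrows.1 hv S ⟨⟨fun b β => rfl⟩, fun j hj a β => ?_⟩ β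
  exact σ_apply_of_ne C (by rintro rfl; exact hk hj) a β

theorem mem_leftCoset_iff {a : A} {w x : C.HomTo a} {J : Finset I} :
    x ∈ leftCoset w J ↔ x.2 ≫ Groupoid.inv w.2 ∈ (C.parabolic J).arrows x.1 w.1 := by
  constructor
  · rintro ⟨v, hv, h⟩
    rwa [h, Category.assoc, Groupoid.comp_inv, Category.comp_id]
  · intro h
    exact ⟨_, h, by rw [Category.assoc, Groupoid.inv_comp, Category.comp_id]⟩

theorem self_mem_leftCoset {a : A} (w : C.HomTo a) (J : Finset I) : w ∈ leftCoset w J :=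
  ⟨𝟙 _, id_mem_parabolic J _, (Category.id_comp _).symm⟩

theorem leftCoset_subset {a : A} {w x : C.HomTo a} {J : Finset I} (h : x ∈ leftCoset w J) :
    leftCoset x J ⊆ leftCoset w J := by
  obtain ⟨v, hv, hx⟩ := h
  rintro y ⟨u, hu, hy⟩
  exact ⟨u ≫ v, (C.parabolic J).mul hu hv, by rw [hy, hx, Category.assoc]⟩

theorem mem_leftCoset_symm {a : A} {w x : C.HomTo a} {J : Finset I} (h : x ∈ leftCoset w J) :
    w ∈ leftCoset x J := by
  obtain ⟨v, hv, hx⟩ := h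
  refine ⟨Groupoid.inv v, (C.parabolic J).inv hv, ?_⟩
  rw [hx, ← Category.assoc, Groupoid.inv_comp, Category.id_comp]

theorem leftCoset_eq {a : A} {w x : C.HomTo a} {J : Finset I} (h : x ∈ leftCoset w J) :
    leftCoset x J = leftCoset w J :=
  (leftCoset_subset h).antisymm (leftCoset_subset (mem_leftCoset_symm h))

/-- The product of `w` with the simple reflection of label `k`. -/
def mulSimple {a : A} (w : C.HomTo a) (k : I) : C.HomTo a :=
  ⟨⟨C.ρ k w.1.obj⟩, Groupoid.inv (C.s k w.1.obj) ≫ w.2⟩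

/-- Since `σ_k` negates `α k`, it changes the `k`-th coordinate. The coset therefore determines its
label `J`. -/
theorem mulSimple_mem_leftCoset_iff {a : A} (w : C.HomTo a) (k : I) (J : Finset I) :
    mulSimple w k ∈ leftCoset w J ↔ k ∈ J := by
  constructor
  · intro h
    by_contra hk
    rw [mem_leftCoset_iff, mulSimple, Category.assoc, Groupoid.comp_inv, Category.comp_id] at h
    have h1 := toAut_apply_of_mem_parabolic h hk (α k)
    rw [toAut_inv, show toAut (C.s k w.1.obj) = C.σ k w.1.obj from rfl, σ_inv, σ_α_self] at h1
    simp [α] at h1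
  · intro hk
    exact ⟨_, (C.parabolic J).inv (s_mem_parabolic hk _), rfl⟩

theorem subset_of_leftCoset_eq {a : A} {w w' : C.HomTo a} {J J' : Finset I}
    (h : leftCoset w J = leftCoset w' J') : J ⊆ J' := by
  intro k hk
  have h1 : w ∈ leftCoset w' J' := h ▸ self_mem_leftCoset w J
  rw [← mulSimple_mem_leftCoset_iff w, leftCoset_eq h1, ← h, mulSimple_mem_leftCoset_iff]
  exact hk

theorem label_eq_of_leftCoset_eq {a : A} {w w' : C.HomTo a} {J J' : Finset I}
    (h : leftCoset w J = leftCoset w' J') : J = J' :=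
  (subset_of_leftCoset_eq h).antisymm (subset_of_leftCoset_eq h.symm)

theorem mem_chamber {a : A} {w : C.HomTo a} {X : Set (C.HomTo a)} :
    X ∈ chamber w ↔ ∃ J : Finset I, J.card + 1 = Fintype.card I ∧ leftCoset w J = X := by
  simp [chamber]

theorem card_chamber_eq {a : A} (u w : C.HomTo a) : (chamber u).card = (chamber w).card := by
  classical
  rw [chamber, chamber, Finset.card_image_of_injective _ fun J J' h => label_eq_of_leftCoset_eq h,
    Finset.card_image_of_injective _ fun J J' h => label_eq_of_leftCoset_eq h]

theorem card_erase_univ_add_one (k : I) : (Finset.univ.erase k).card + 1 = Fintype.card I :=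
  Finset.card_erase_add_one (Finset.mem_univ k)

theorem chamber_mem_faces [Nonempty I] {a : A} (w : C.HomTo a) :
    chamber w ∈ (C.coxeterComplex a).faces := by
  obtain ⟨k⟩ := ‹Nonempty I›
  refine ⟨⟨_, mem_chamber.2 ⟨_, card_erase_univ_add_one k, rfl⟩⟩, fun X hX => ?_, w, ?_⟩
  · obtain ⟨J, hJ, rfl⟩ := mem_chamber.1 hX
    exact ⟨w, J, hJ, rfl⟩
  · simp only [Set.mem_iInter]
    intro X hX
    obtain ⟨J, hJ, rfl⟩ := mem_chamber.1 hX
    exact self_mem_leftCoset w J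

theorem exists_subset_chamber {a : A} {F : Finset (Set (C.HomTo a))}
    (hF : F ∈ (C.coxeterComplex a).faces) : ∃ w : C.HomTo a, F ⊆ chamber w := by
  obtain ⟨-, hv, x, hx⟩ := hF
  simp only [Set.mem_iInter] at hx
  refine ⟨x, fun X hX => ?_⟩
  obtain ⟨w, J, hJ, rfl⟩ := hv X hX
  exact mem_chamber.2 ⟨J, hJ, leftCoset_eq (hx _ hX)⟩

/-- Any element of the intersection of a face's cosets represents all of them, so the face lies in
that element's chamber. All chambers have the same size, so none properly contains another. -/
theorem maximal_face_iff [Nonempty I] {a : A} {F : Finset (Set (C.HomTo a))} :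
    Maximal (· ∈ (C.coxeterComplex a).faces) F ↔ ∃ w : C.HomTo a, chamber w = F := by
  constructor
  · intro h
    obtain ⟨w, hw⟩ := exists_subset_chamber h.1
    exact ⟨w, (h.eq_of_le (chamber_mem_faces w) hw).symm⟩
  · rintro ⟨w, rfl⟩
    refine ⟨chamber_mem_faces w, fun G hG hwG => ?_⟩
    obtain ⟨u, hu⟩ := exists_subset_chamber hG
    rw [Finset.eq_of_subset_of_card_le (hwG.trans hu) (card_chamber_eq u w).le]
    exact hu

theorem chamber_mulSimple_inter {a : A} (w : C.HomTo a) (k : I) :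
    (chamber (mulSimple w k) ∩ chamber w : Set (Set (C.HomTo a))) =
      (chamber w : Set (Set (C.HomTo a))) \ {leftCoset w (Finset.univ.erase k)} := by
  ext X
  simp only [Set.mem_inter_iff, Finset.mem_coe, Set.mem_sdiff, Set.mem_singleton_iff]
  constructor
  · rintro ⟨h1, h2⟩
    refine ⟨h2, ?_⟩
    rintro rfl
    obtain ⟨J, -, hJ⟩ := mem_chamber.1 h1
    have h3 := self_mem_leftCoset (mulSimple w k) J
    rw [hJ, mulSimple_mem_leftCoset_iff] at h3
    simp at h3
  · rintro ⟨h1, h2⟩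
    refine ⟨?_, h1⟩
    obtain ⟨J, hJ, rfl⟩ := mem_chamber.1 h1
    refine mem_chamber.2 ⟨J, hJ, leftCoset_eq ((mulSimple_mem_leftCoset_iff w k J).2 ?_)⟩
    by_contra hk
    refine h2 (congrArg _ (Finset.eq_of_subset_of_card_le (fun l hl => ?_) ?_))
    · exact Finset.mem_erase.2 ⟨by rintro rfl; exact hk hl, Finset.mem_univ l⟩
    · have := card_erase_univ_add_one k
      omega

/-- A morphism is determined by its source and the images of the simple roots, for which there are
finitely many choices. -/
theorem finite_homTo [Finite A] (hfin : ∀ b, (C.realRoots b).Finite) (a : A) :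
    Finite (C.HomTo a) := by
  have := (hfin a).to_subtype
  let φ : C.HomTo a → A × (I → C.realRoots a) :=
    fun w => (w.1.obj, fun k => ⟨toAut w.2 (α k), w, k, rfl⟩)
  refine Finite.of_injective φ ?_
  rintro ⟨⟨b⟩, f⟩ ⟨⟨c⟩, g⟩ h
  obtain rfl : b = c := congrArg Prod.fst h
  have hfg : f = g := by
    refine WeylHom.ext (LinearEquiv.ext fun v => ?_)
    rw [map_eq_sum_α, map_eq_sum_α]
    refine Finset.sum_congr rfl fun k _ => ?_
    exact congrArg (v k • ·) (congrArg Subtype.val (congrFun (congrArg Prod.snd h) k))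
  rw [hfg]

/-! ### Weak order and intersections of chambers. -/

variable [Nonempty I] {R : A → Set (I → ℤ)}

/-- Equal chambers have equal vertices label by label, so the quotient of `u` and `w` preserves
every coordinate and is the identity map. -/
theorem chamber_injective (hR : C.IsRootSystem R) (hfin : ∀ a, (R a).Finite) {a : A} :
    Function.Injective (chamber : C.HomTo a → Finset (Set (C.HomTo a))) := by
  intro u w h
  refine homTo_eq_of_toAut_eq_one hR hfin (v := u.2 ≫ Groupoid.inv w.2)
    (by rw [Category.assoc, Groupoid.inv_comp, Category.comp_id])
    (LinearEquiv.ext fun β => funext fun k => ?_)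
  have h1 : leftCoset u (Finset.univ.erase k) ∈ chamber w :=
    h ▸ mem_chamber.2 ⟨_, card_erase_univ_add_one k, rfl⟩
  obtain ⟨J, -, hJ⟩ := mem_chamber.1 h1
  obtain rfl := label_eq_of_leftCoset_eq hJ
  have h2 := self_mem_leftCoset u (Finset.univ.erase k)
  rw [← hJ, mem_leftCoset_iff] at h2
  exact toAut_apply_of_mem_parabolic h2 (by simp) β

theorem weakLE_mulSimple (hR : C.IsRootSystem R) (hfin : ∀ a, (R a).Finite) {a : A}
    {w : C.HomTo a} {k : I} (hk : 0 ≤ -toAut w.2 (α k)) : WeakLE (mulSimple w k) w := by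
  refine weakLE_of_comp hR hfin (C.s k w.1.obj) ?_ ?_
  · change w.2 = C.s k w.1.obj ≫ Groupoid.inv (C.s k w.1.obj) ≫ w.2
    rw [← Category.assoc, Groupoid.comp_inv]
    exact (Category.id_comp _).symm
  · intro β hβ h0 hn
    have h1 : β = α k := by
      by_contra hne
      refine hn ?_
      have := hR.σ_nonneg hβ h0 hne
      rwa [show (mulSimple w k).1.obj = C.ρ k w.1.obj from rfl, σ_ρ, ← σ_inv] at this
    rw [h1, show toAut (mulSimple w k).2 = toAut w.2 * (C.σ k w.1.obj)⁻¹ from rfl, σ_inv,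
      LinearEquiv.mul_apply, σ_α_self, map_neg]
    exact hk

theorem weakLE_of_leftCoset_eq (hR : C.IsRootSystem R) (hfin : ∀ a, (R a).Finite) {a : A}
    {u w : C.HomTo a} (h : ∀ k, 0 ≤ -toAut w.2 (α k) →
      leftCoset u (Finset.univ.erase k) = leftCoset w (Finset.univ.erase k)) : WeakLE w u := by
  refine weakLE_of_comp hR hfin (u.2 ≫ Groupoid.inv w.2)
    (by rw [Category.assoc, Groupoid.inv_comp, Category.comp_id]) fun β hβ h0 hn => ?_
  obtain ⟨n, hn1⟩ := exists_ascends hR hfin (u.2 ≫ Groupoid.inv w.2)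
  have hm := (hn1.isRootMap hR).1
  have hvv : ∀ γ, toAut (u.2 ≫ Groupoid.inv w.2) ((toAut (u.2 ≫ Groupoid.inv w.2))⁻¹ γ) = γ :=
    fun γ => LinearEquiv.congr_fun (mul_inv_cancel (toAut (u.2 ≫ Groupoid.inv w.2))) γ
  have hneg := (hR.nonneg_or ((hm _).1 (by rw [hvv]; exact hβ))).resolve_left hn
  obtain ⟨p, hp⟩ := exists_ascends hR hfin w.2
  rw [map_eq_sum_α]
  refine Finset.sum_nonneg fun k _ => ?_
  rcases hR.nonneg_or (((hp.isRootMap hR).1 (α k)).2 (hR.α_mem _ k)) with hk | hk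
  · exact smul_nonneg (h0 k) hk
  · have h1 : u ∈ leftCoset w (Finset.univ.erase k) := h k hk ▸ self_mem_leftCoset u _
    rw [mem_leftCoset_iff] at h1
    have h2 := toAut_apply_of_mem_parabolic h1 (k := k) (by simp)
      ((toAut (u.2 ≫ Groupoid.inv w.2))⁻¹ β)
    rw [hvv] at h2
    have h3 := hneg k
    have h4 := h0 k
    simp only [Pi.zero_apply, Pi.neg_apply] at h3 h4
    have h5 : β k = 0 := by omega
    simp [h5]

theorem exists_chamber_inter (hR : C.IsRootSystem R) (hfin : ∀ a, (R a).Finite) {a : A}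
    {u w : C.HomTo a} (huw : ¬ WeakLE w u) :
    ∃ x : C.HomTo a, WeakLE x w ∧ x ≠ w ∧ ∃ ω ∈ chamber w,
      (chamber u ∩ chamber w : Set (Set (C.HomTo a))) ⊆ chamber x ∩ chamber w ∧
      (chamber x ∩ chamber w : Set (Set (C.HomTo a))) = (chamber w : Set _) \ {ω} := by
  obtain ⟨k, hk, hne⟩ : ∃ k, 0 ≤ -toAut w.2 (α k) ∧
      leftCoset u (Finset.univ.erase k) ≠ leftCoset w (Finset.univ.erase k) := by
    by_contra! hcon
    exact huw (weakLE_of_leftCoset_eq hR hfin hcon)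
  refine ⟨mulSimple w k, weakLE_mulSimple hR hfin hk, fun h => ?_, _,
    mem_chamber.2 ⟨_, card_erase_univ_add_one k, rfl⟩, ?_, chamber_mulSimple_inter w k⟩
  · have h1 : mulSimple w k ∈ leftCoset w (Finset.univ.erase k) := by
      rw [h]
      exact self_mem_leftCoset w _
    rw [mulSimple_mem_leftCoset_iff] at h1
    simp at h1
  · rw [chamber_mulSimple_inter]
    rintro X ⟨h1, h2⟩
    refine ⟨h2, ?_⟩
    rintro rfl
    obtain ⟨J, -, hJ⟩ := mem_chamber.1 (Finset.mem_coe.1 h1)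
    obtain rfl := label_eq_of_leftCoset_eq hJ
    exact hne hJ

end Cosets

end CartanScheme

theorem mainTheorem10 {I A : Type*} [Fintype I] [DecidableEq I] [Nonempty I] [Finite A]
    (C : CartanScheme I A)
    (hroot : C.IsRootSystem C.realRoots)
    (hfin : ∀ b : A, (C.realRoots b).Finite)
    (a : A)
    (r : C.HomTo a → C.HomTo a → Prop) (hlin : IsLinearOrder (C.HomTo a) r)
    (hext : ∀ u w : C.HomTo a, CartanScheme.WeakLE u w → r u w) :
    ∃ (n : ℕ) (e : Fin n ≃ C.HomTo a),
      (∀ i j : Fin n, i ≤ j ↔ r (e i) (e j)) ∧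
      (C.coxeterComplex a).IsShelling (fun i => CartanScheme.chamber (e i)) := by
  classical
  have := CartanScheme.finite_homTo hfin a
  have := Fintype.ofFinite (C.HomTo a)
  let _ : LinearOrder (C.HomTo a) :=
    { le := r
      le_refl := hlin.refl
      le_trans := hlin.trans
      le_antisymm := hlin.antisymm
      le_total := hlin.total
      toDecidableLE := Classical.decRel _ }
  let e : Fin (Fintype.card (C.HomTo a)) ≃o C.HomTo a := Fintype.orderIsoFinOfCardEq _ rfl
  have he : ∀ i j, i ≤ j ↔ r (e i) (e j) := fun i j => e.le_iff_le.symm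
  refine ⟨_, e.toEquiv, he, ?_, ?_, ?_, ?_⟩
  · intro F G hF hG
    obtain ⟨u, rfl⟩ := CartanScheme.maximal_face_iff.1 hF
    obtain ⟨w, rfl⟩ := CartanScheme.maximal_face_iff.1 hG
    exact CartanScheme.card_chamber_eq u w
  · exact (CartanScheme.chamber_injective hroot hfin).comp e.injective
  · ext F
    rw [Set.mem_ofPred_eq, CartanScheme.maximal_face_iff, e.surjective.exists]
    rfl
  · intro i j hij
    obtain ⟨x, hx, hxne, hω⟩ := CartanScheme.exists_chamber_inter hroot hfin
      (u := e i) (w := e j) fun h => absurd ((he j i).2 (hext _ _ h)) (not_le.2 hij)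
    obtain ⟨l, rfl⟩ := e.surjective x
    exact ⟨l, lt_of_le_of_ne ((he l j).2 (hext _ _ hx)) (by rintro rfl; exact hxne rfl), hω⟩
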